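/- Let $\{0,1\}^*$ be the set of finite binary strings and let $|p|$ denote the length of a string $p$. A prefix-free machine is a partial computable function $M$ from $\{0,1\}^*$ to $\{0,1\}^*$ such that no string in its domain is a proper prefix of another string in its domain. A prefix-free machine $U$ is optimal if for every prefix-free machine $M$ there is $d\in\mathbb N$ such that for every $p\in\operatorname{Dom}M$ there is $q\in\operatorname{Dom}U$ with $U(q)=M(p)$ and $|q|\le|p|+d$. For real $T>0$ put $Z(T)=\sum_{p\in\operatorname{Dom}U}2^{-|p|/T}$, so that $Z(1)$ is Chaitin's $\Omega$. For an infinite binary sequence $X$ let $X(n)$ be its $n$th bit ($n\ge1$) and $X{\restriction}_n$ the string of its first $n$ bits. Call $X$ strongly predictable if there is a partial computable function $F$ from $\{0,1\}^*$ to $\{0,1,N\}$ such that (i) $F(X{\restriction}_n)$ is defined for every $n\in\mathbb N$; (ii) for every $n\in\mathbb N$, if $F(X{\restriction}_n)\ne N$ then $F(X{\restriction}_n)=X(n+1)$; and (iii) the set $\{n\in\mathbb N : F(X{\restriction}_n)\neq N\}$ is infinite. Theorem. For every optimal prefix-free machine $U$, the infinite binary sequence given by the base-two expansion, with infinitely many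 zeros, of the fractional part of $Z(1)$ is not strongly predictable. -/

import Mathlib

/-- Finite binary strings. -/
abbrev BinStr : Type := List Bool

/-- Infinite binary sequences, indexed from `0`: the `(n+1)`-st bit of `X` is `X n`. -/
abbrev BinSeq : Type := ℕ → Bool

/-- The string of the first `n` bits of an infinite binary sequence. -/
def BinSeq.pre (X : BinSeq) (n : ℕ) : BinStr := (List.range n).map X

/-- A prefix-free machine: a partial computable function from strings to strings such that no
string in its domain is a proper prefix of another string in its domain. -/
structure IsPrefixFreeMachine (M : BinStr →. BinStr) : Prop where
  partrec : Partrec M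
  prefix_free : ∀ p q : BinStr, (M p).Dom → (M q).Dom → p <+: q → p = q

/-- An optimal prefix-free machine: it simulates every prefix-free machine with programs that are
longer by at most a constant. -/
structure IsOptimalPrefixFreeMachine (U : BinStr →. BinStr) : Prop where
  prefixFreeMachine : IsPrefixFreeMachine U
  optimal : ∀ M : BinStr →. BinStr, IsPrefixFreeMachine M →
    ∃ d : ℕ, ∀ p x : BinStr, x ∈ M p → ∃ q : BinStr, x ∈ U q ∧ q.length ≤ p.length + d

/-- The partition function `Z(T) = ∑_{p ∈ Dom U} 2^(-|p|/T)` of a machine `U` at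
temperature `T`. For a prefix-free `U` and `0 < T ≤ 1` the series converges, by Kraft's
inequality; at `T = 1` its sum is Chaitin's `Ω` of `U`. -/
noncomputable def partitionFunction (U : BinStr →. BinStr) (T : ℝ) : ℝ :=
  ∑' p : {p : BinStr // (U p).Dom}, (2 : ℝ) ^ (-(p.val.length : ℝ) / T)

/-- The base-two expansion of the fractional part of a real, with infinitely many zeros: the
`(n+1)`-st bit is the parity of `⌊fract α * 2^(n+1)⌋`. -/
noncomputable def binaryExpansion (α : ℝ) : BinSeq :=
  fun n => decide (Real.digits (Int.fract α) 2 n = 1)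

/-- `X` is strongly predictable: some partial computable `F`, with values in `{0, 1, N}` (here
`some false`, `some true`, `none`; the value `none` means that the prediction is suspended), is
defined on every prefix of `X`, predicts the next bit correctly whenever it makes a prediction,
and makes a prediction for infinitely many prefixes. -/
def StronglyPredictable (X : BinSeq) : Prop :=
  ∃ F : BinStr →. Option Bool, Partrec F ∧
    (∀ n : ℕ, (F (X.pre n)).Dom) ∧
    (∀ (n : ℕ) (b : Bool), some b ∈ F (X.pre n) → b = X n) ∧
    {n : ℕ | none ∉ F (X.pre n)}.Infinite

/-!
A strong predictor would compress prefixes of `Ω = Z(1)` by an unbounded amount,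
whereas a prefix of `Ω` of length `n` computes a string of complexity at least `n`.

Compression. While a partial computable `F` predicts `X`, a prefix of `X` in which `F` makes `2k`
predictions can be recovered from its remaining bits: a decoder runs `F` on what it has written so
far, copies the predicted bit if there is one, reads an input bit otherwise, and stops after `2k`
predictions. Since the decoder decides by itself when to stop, it is prefix-free once `k` is known
(`decoder_prefix_free`), and `k` is passed in a header of `k + 1` bits. So `decompress F` is a
prefix-free machine that writes prefixes of `X` of length `n` from inputs of length `n - k + 1`
(`exists_decompress_eq_pre`).

Incompressibility. The machine `U` is the limit of computable finite stages. Given the first `n`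
bits of `Ω` (and the integer part of `Ω`, a constant), one can search for a stage whose Kraft sum
exceeds the truncation of `Ω` to `n` bits minus `2 ^ (-n)`. Such a stage exists, also when `Ω` is
dyadic, and it misses less than `2 ^ (1 - n)` of `Ω`, hence no halting program shorter than `n`.
A string longer than all outputs of that stage is thus no output of a program shorter than `n`
(`IsStageApprox.exists_mem_escape`).

The composition of the two is a prefix-free machine which, for `k` large enough, contradicts the
optimality of `U`. Kraft's inequality enters only to make the series `Z(1)` converge; it is obtained
from the Kraft–McMillan inequality.
-/

/-! ### Kraft sums of prefix-free machines -/

/-- A prefix-free set of nonempty strings is uniquely decodable. -/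
theorem uniquelyDecodable_of_prefixFree {α : Type*} {S : Set (List α)} (hnil : [] ∉ S)
    (hS : ∀ p ∈ S, ∀ q ∈ S, p <+: q → p = q) : InformationTheory.UniquelyDecodable S := by
  intro L₁
  induction L₁ with
  | nil =>
    intro L₂ _ h₂ h
    cases L₂ with
    | nil => rfl
    | cons w L₂ =>
      have hw : w = [] := by simp at h; exact h.1
      exact absurd (hw ▸ h₂ w (by simp)) hnil
  | cons v L₁ ih =>
    intro L₂ h₁ h₂ h
    cases L₂ with
    | nil =>
      have hv : v = [] := by simp at h; exact h.1
      exact absurd (hv ▸ h₁ v (by simp)) hnil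
    | cons w L₂ =>
      simp only [List.flatten_cons] at h
      have hv := h₁ v (by simp)
      have hw := h₂ w (by simp)
      have hvw : v = w := by
        rcases List.append_eq_append_iff.1 h with ⟨a, ha, _⟩ | ⟨a, ha, _⟩
        · exact hS v hv w hw ⟨a, ha.symm⟩
        · exact (hS w hw v hv ⟨a, ha.symm⟩).symm
      subst hvw
      rw [ih L₂ (fun x hx => h₁ x (by simp [hx])) (fun x hx => h₂ x (by simp [hx]))
        (List.append_cancel_left h)]

/-- **Kraft's inequality** for finite prefix-free sets of binary strings. -/
theorem kraft_of_prefixFree (S : Finset BinStr) (hS : ∀ p ∈ S, ∀ q ∈ S, p <+: q → p = q) :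
    ∑ p ∈ S, (1 / 2 : ℝ) ^ p.length ≤ 1 := by
  by_cases hnil : [] ∈ S
  · -- The empty string is a prefix of every string, hence it is the only element.
    have : S = {[]} := by
      refine Finset.eq_singleton_iff_unique_mem.2 ⟨hnil, fun p hp => ?_⟩
      exact (hS [] hnil p hp List.nil_prefix).symm
    simp [this]
  · have h := InformationTheory.kraft_mcmillan_inequality (S := S)
      (uniquelyDecodable_of_prefixFree (by simpa using hnil) (by simpa using hS))
    simpa using h

theorem IsPrefixFreeMachine.summable {U : BinStr →. BinStr} (hU : IsPrefixFreeMachine U) :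
    Summable fun p : {p : BinStr // (U p).Dom} => (1 / 2 : ℝ) ^ p.val.length := by
  refine summable_of_sum_le (c := 1) (fun _ => by positivity) fun S => ?_
  have h := kraft_of_prefixFree (S.map (Function.Embedding.subtype _)) (by
    intro p hp q hq hpq
    simp only [Finset.mem_map, Function.Embedding.subtype_apply, Subtype.exists,
      exists_and_right, exists_eq_right] at hp hq
    exact hU.prefix_free p q hp.1 hq.1 hpq)
  simpa using h

theorem partitionFunction_one (U : BinStr →. BinStr) :
    partitionFunction U 1 = ∑' p : {p : BinStr // (U p).Dom}, (1 / 2 : ℝ) ^ p.val.length := by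
  refine tsum_congr fun p => ?_
  rw [div_one, Real.rpow_neg (by norm_num), Real.rpow_natCast, one_div, inv_pow]

/-! ### Computable approximation of a machine by finite stages -/

/-- `u t p` is the output of the partial function `U` on input `p`, if it is found within `t`
steps: a primitive recursive increasing approximation of `U`. -/
structure IsStageApprox (U : BinStr →. BinStr) (u : ℕ → BinStr → Option BinStr) : Prop where
  primrec : Primrec₂ u
  mono : ∀ {s t p x}, s ≤ t → u s p = some x → u t p = some x
  mem_iff : ∀ {p x}, x ∈ U p ↔ ∃ t, u t p = some x

theorem Partrec.exists_isStageApprox {U : BinStr →. BinStr} (hU : Partrec U) :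
    ∃ u, IsStageApprox U u := by
  obtain ⟨c, hc⟩ := Nat.Partrec.Code.exists_code.1 hU
  have hmem : ∀ p y, y ∈ c.eval (Encodable.encode p) ↔ ∃ x ∈ U p, Encodable.encode x = y := by
    intro p y
    rw [hc]
    simp
  refine ⟨fun t p => (c.evaln t (Encodable.encode p)).bind Encodable.decode, ?_, ?_, ?_⟩
  · refine Primrec.option_bind (Nat.Partrec.Code.primrec_evaln.comp
      ((Primrec.fst.pair (Primrec.const c)).pair (Primrec.encode.comp Primrec.snd))) ?_
    exact Primrec.decode.comp Primrec.snd
  · intro s t p x hst h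
    obtain ⟨y, hy, hyx⟩ := Option.bind_eq_some_iff.1 h
    exact Option.bind_eq_some_iff.2 ⟨y, Nat.Partrec.Code.evaln_mono hst hy, hyx⟩
  · intro p x
    constructor
    · intro hx
      obtain ⟨t, ht⟩ := Nat.Partrec.Code.evaln_complete.1 ((hmem p _).2 ⟨x, hx, rfl⟩)
      exact ⟨t, Option.bind_eq_some_iff.2 ⟨_, ht, Encodable.encodek x⟩⟩
    · rintro ⟨t, ht⟩
      obtain ⟨y, hy, hyx⟩ := Option.bind_eq_some_iff.1 ht
      obtain ⟨x', hx', rfl⟩ := (hmem p y).1 (Nat.Partrec.Code.evaln_sound hy)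
      rw [Encodable.encodek] at hyx
      exact Option.some.inj hyx ▸ hx'

section Stages

variable (u : ℕ → BinStr → Option BinStr)

/-- The programs with code below `t` that are seen to halt by stage `t`. `Encodable.decode₂` is
injective where it is defined, so that no program is listed twice. -/
def haltedBy (t : ℕ) : List BinStr :=
  (List.range t).filterMap fun i =>
    (Encodable.decode₂ BinStr i).bind fun p => (u t p).map fun _ => p

/-- The outputs of the programs in `haltedBy u t`. -/
def outputsBy (t : ℕ) : List BinStr :=
  (haltedBy u t).filterMap (u t)

/-- The integer `2 ^ t * ∑ 2 ^ (-|p|)`, the sum being over `haltedBy u t`. The exponents are not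
truncated, since the length of a string is at most its code, which is below `t`. -/
def haltedWeight (t : ℕ) : ℕ :=
  ((haltedBy u t).map fun p => 2 ^ (t - p.length)).sum

variable {u}

theorem mem_haltedBy {t : ℕ} {p : BinStr} :
    p ∈ haltedBy u t ↔ Encodable.encode p < t ∧ ∃ x, u t p = some x := by
  simp only [haltedBy, List.mem_filterMap, List.mem_range, Option.bind_eq_some_iff,
    Option.map_eq_some_iff, Encodable.decode₂_eq_some]
  constructor
  · rintro ⟨_, hi, q, rfl, x, hx, rfl⟩
    exact ⟨hi, x, hx⟩
  · rintro ⟨hi, x, hx⟩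
    exact ⟨_, hi, p, rfl, x, hx, rfl⟩

theorem nodup_haltedBy (t : ℕ) : (haltedBy u t).Nodup := by
  refine List.Nodup.filterMap ?_ List.nodup_range
  intro i j p hi hj
  simp only [Option.mem_def, Option.bind_eq_some_iff, Option.map_eq_some_iff,
    Encodable.decode₂_eq_some] at hi hj
  obtain ⟨_, rfl, _, _, rfl⟩ := hi
  obtain ⟨_, rfl, _, _, rfl⟩ := hj
  rfl

theorem mem_outputsBy {t : ℕ} {p x : BinStr} (hp : p ∈ haltedBy u t) (hx : u t p = some x) :
    x ∈ outputsBy u t :=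
  List.mem_filterMap.2 ⟨p, hp, hx⟩

theorem cast_haltedWeight (t : ℕ) :
    (haltedWeight u t : ℝ) = 2 ^ t * ∑ p ∈ (haltedBy u t).toFinset, (1 / 2 : ℝ) ^ p.length := by
  rw [List.sum_toFinset _ (nodup_haltedBy t), haltedWeight, Nat.cast_list_sum, List.map_map,
    ← List.sum_map_mul_left]
  congr 1
  refine List.map_congr_left fun p hp => ?_
  have hlt : p.length ≤ t := (Encodable.length_le_encode p).trans (mem_haltedBy.1 hp).1.le
  simp only [Function.comp_apply, Nat.cast_pow, Nat.cast_ofNat, one_div, inv_pow]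
  rw [← div_eq_mul_inv, eq_div_iff (by positivity), ← pow_add, Nat.sub_add_cancel hlt]

theorem primrec_two_pow : Primrec fun n : ℕ => 2 ^ n := by
  refine (Primrec.nat_rec₁ (f := fun _ v => 2 * v) 1
    (Primrec.nat_double.comp Primrec.snd)).of_eq fun n => ?_
  induction n with
  | zero => rfl
  | succ n ih => rw [pow_succ', ← ih]

theorem primrec_haltedBy (hu : Primrec₂ u) : Primrec (haltedBy u) := by
  refine Primrec.listFilterMap Primrec.list_range ?_
  refine Primrec.option_bind (Primrec.decode₂.comp Primrec.snd) ?_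
  refine Primrec.option_map (hu.comp (Primrec.fst.comp Primrec.fst) Primrec.snd) ?_
  exact Primrec.snd.comp Primrec.fst

theorem primrec_outputsBy (hu : Primrec₂ u) : Primrec (outputsBy u) :=
  Primrec.listFilterMap (primrec_haltedBy hu) hu

theorem primrec_haltedWeight (hu : Primrec₂ u) : Primrec (haltedWeight u) := by
  have hmap : Primrec fun t => (haltedBy u t).map fun p => 2 ^ (t - p.length) :=
    Primrec.list_map (primrec_haltedBy hu) (primrec_two_pow.comp
      (Primrec.nat_sub.comp Primrec.fst (Primrec.list_length.comp Primrec.snd)))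
  refine (Primrec.list_foldr hmap (Primrec.const 0) (h := fun _ v => v.1 + v.2)
    (Primrec.nat_add.comp (Primrec.fst.comp Primrec.snd)
      (Primrec.snd.comp Primrec.snd))).of_eq fun t => ?_
  simp [haltedWeight, List.sum]

end Stages

/-- Stages exhaust the partition function: the weight at some stage comes within any `ε > 0`. -/
theorem IsStageApprox.exists_stage {U : BinStr →. BinStr} {u : ℕ → BinStr → Option BinStr}
    (hu : IsStageApprox U u) (hU : IsPrefixFreeMachine U) {ε : ℝ} (hε : 0 < ε) :
    ∃ t, partitionFunction U 1 <
      ∑ p ∈ (haltedBy u t).toFinset, (1 / 2 : ℝ) ^ p.length + ε := by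
  have hsum := hU.summable.hasSum
  rw [← partitionFunction_one] at hsum
  obtain ⟨S, hS⟩ := (hsum.eventually (lt_mem_nhds (sub_lt_self _ hε))).exists
  have hbound : ∀ S : Finset {p : BinStr // (U p).Dom}, ∃ t, ∀ p ∈ S, p.val ∈ haltedBy u t := by
    intro S
    have hp : ∀ p : {p : BinStr // (U p).Dom}, ∃ t, p.val ∈ haltedBy u t := by
      rintro ⟨p, hp⟩
      obtain ⟨s, hs⟩ := hu.mem_iff.1 (Part.get_mem hp)
      exact ⟨max s (Encodable.encode p + 1), mem_haltedBy.2
        ⟨by simp, _, hu.mono (le_max_left _ _) hs⟩⟩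
    choose T hT using hp
    refine ⟨S.sup T, fun p hpS => ?_⟩
    have hle := Finset.le_sup (f := T) hpS
    obtain ⟨h₁, x, h₂⟩ := mem_haltedBy.1 (hT p)
    exact mem_haltedBy.2 ⟨h₁.trans_le hle, x, hu.mono hle h₂⟩
  obtain ⟨t, ht⟩ := hbound S
  refine ⟨t, ?_⟩
  have : ∑ p ∈ S, (1 / 2 : ℝ) ^ p.val.length ≤
      ∑ p ∈ (haltedBy u t).toFinset, (1 / 2 : ℝ) ^ p.length := by
    refine (Finset.sum_map S (Function.Embedding.subtype _)
      fun p : BinStr => (1 / 2 : ℝ) ^ p.length).symm.trans_le ?_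
    refine Finset.sum_le_sum_of_subset_of_nonneg ?_ fun _ _ _ => by positivity
    intro p hp
    obtain ⟨q, hq, rfl⟩ := Finset.mem_map.1 hp
    exact List.mem_toFinset.2 (ht q hq)
  linarith

/-- A halting program not listed at stage `t` contributes its weight to what is missing from the
partition function at stage `t`. -/
theorem IsStageApprox.weight_add_le {U : BinStr →. BinStr} {u : ℕ → BinStr → Option BinStr}
    (hu : IsStageApprox U u) (hU : IsPrefixFreeMachine U) {t : ℕ} {q : BinStr} (hq : (U q).Dom)
    (hqt : q ∉ haltedBy u t) :
    ∑ p ∈ (haltedBy u t).toFinset, (1 / 2 : ℝ) ^ p.length + (1 / 2) ^ q.length ≤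
      partitionFunction U 1 := by
  have hdom : ∀ p ∈ insert q (haltedBy u t).toFinset, (U p).Dom := by
    intro p hp
    rcases Finset.mem_insert.1 hp with rfl | hp
    · exact hq
    · obtain ⟨_, x, hx⟩ := mem_haltedBy.1 (List.mem_toFinset.1 hp)
      exact Part.dom_iff_mem.2 ⟨x, hu.mem_iff.2 ⟨t, hx⟩⟩
  have : DecidablePred fun p => (U p).Dom := Classical.decPred _
  rw [add_comm, ← Finset.sum_insert (f := fun p : BinStr => (1 / 2 : ℝ) ^ p.length)
    (by simpa using hqt), partitionFunction_one,
    ← Finset.sum_subtype_of_mem (fun p : BinStr => (1 / 2 : ℝ) ^ p.length) hdom]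
  exact hU.summable.sum_le_tsum _ fun _ _ => by positivity

/-! ### Decompression by a predictor -/

/-- A state `(c, τ, σ)` of the decoder: the number `c` of predictions still to be used, the unread
input `τ`, and the string `σ` written so far. -/
abbrev DecoderState : Type := ℕ × BinStr × BinStr

/-- One step of the decoder, given the value `o` of the predictor at the written string: append the
predicted bit if there is one, and otherwise the next input bit. The decoder stops when all
predictions are used, and then it succeeds only if all input has been read. -/
def decoderNext : DecoderState → Option Bool → Option (BinStr ⊕ DecoderState)
  | (0, [], σ), _ => some (Sum.inl σ)
  | (0, _ :: _, _), _ => none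
  | (c + 1, τ, σ), some b => some (Sum.inr (c, τ, σ ++ [b]))
  | (_ + 1, [], _), none => none
  | (c + 1, b :: τ, σ), none => some (Sum.inr (c + 1, τ, σ ++ [b]))

theorem primrec_decoderNext : Primrec₂ decoderNext := by
  have hc : Primrec fun a : DecoderState × Option Bool => a.1.1 :=
    Primrec.fst.comp Primrec.fst
  have hτ : Primrec fun a : DecoderState × Option Bool => a.1.2.1 :=
    Primrec.fst.comp (Primrec.snd.comp Primrec.fst)
  have hσ : Primrec fun a : DecoderState × Option Bool => a.1.2.2 :=
    Primrec.snd.comp (Primrec.snd.comp Primrec.fst)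
  have hmk : Primrec fun a : ℕ × BinStr × BinStr × Bool =>
      (Sum.inr (a.1, a.2.1, a.2.2.1 ++ [a.2.2.2]) : BinStr ⊕ DecoderState) := by
    have h₁ : Primrec fun a : ℕ × BinStr × BinStr × Bool => a.2.2.1 ++ [a.2.2.2] :=
      Primrec.list_concat.comp (Primrec.fst.comp (Primrec.snd.comp Primrec.snd))
        (Primrec.snd.comp (Primrec.snd.comp Primrec.snd))
    have h₂ : Primrec fun a : ℕ × BinStr × BinStr × Bool => a.2.1 :=
      Primrec.fst.comp Primrec.snd
    exact Primrec.sumInr.comp (Primrec.fst.pair (h₂.pair h₁))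
  have hzero : Primrec fun a : DecoderState × Option Bool =>
      bif a.1.2.1.head?.isSome then none
      else (some (Sum.inl a.1.2.2) : Option (BinStr ⊕ DecoderState)) :=
    Primrec.cond (Primrec.option_isSome.comp (Primrec.list_head?.comp hτ)) (Primrec.const none)
      (Primrec.option_some.comp (Primrec.sumInl.comp hσ))
  have hread : Primrec fun a : (DecoderState × Option Bool) × ℕ => a.1.1.2.1.head?.map fun b =>
      (Sum.inr (a.2 + 1, a.1.1.2.1.tail, a.1.1.2.2 ++ [b]) : BinStr ⊕ DecoderState) := by
    have h₁ : Primrec fun a : ((DecoderState × Option Bool) × ℕ) × Bool =>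
        (a.1.2 + 1, a.1.1.1.2.1.tail, a.1.1.1.2.2, a.2) :=
      (Primrec.succ.comp (Primrec.snd.comp Primrec.fst)).pair
        ((Primrec.list_tail.comp (hτ.comp (Primrec.fst.comp Primrec.fst))).pair
          ((hσ.comp (Primrec.fst.comp Primrec.fst)).pair Primrec.snd))
    exact Primrec.option_map (Primrec.list_head?.comp (hτ.comp Primrec.fst)) (hmk.comp h₁ :)
  have hpredict : Primrec₂ fun (a : (DecoderState × Option Bool) × ℕ) (b : Bool) =>
      (Sum.inr (a.2, a.1.1.2.1, a.1.1.2.2 ++ [b]) : BinStr ⊕ DecoderState) := by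
    have h₁ : Primrec fun a : ((DecoderState × Option Bool) × ℕ) × Bool =>
        (a.1.2, a.1.1.1.2.1, a.1.1.1.2.2, a.2) :=
      (Primrec.snd.comp Primrec.fst).pair ((hτ.comp (Primrec.fst.comp Primrec.fst)).pair
        ((hσ.comp (Primrec.fst.comp Primrec.fst)).pair Primrec.snd))
    exact (hmk.comp h₁ :)
  have hsucc : Primrec₂ fun (a : DecoderState × Option Bool) (c : ℕ) =>
      bif a.2.isSome then a.2.map fun b =>
        (Sum.inr (c, a.1.2.1, a.1.2.2 ++ [b]) : BinStr ⊕ DecoderState)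
      else a.1.2.1.head?.map fun b =>
        (Sum.inr (c + 1, a.1.2.1.tail, a.1.2.2 ++ [b]) : BinStr ⊕ DecoderState) :=
    Primrec.cond (Primrec.option_isSome.comp (Primrec.snd.comp Primrec.fst))
      (Primrec.option_map (Primrec.snd.comp Primrec.fst) hpredict) hread
  refine (Primrec.nat_casesOn hc hzero hsucc).of_eq ?_
  rintro ⟨⟨_ | c, _ | ⟨b, τ⟩, σ⟩, _ | b'⟩ <;> rfl

/-- A step of the decoder with predictor `F`. -/
def decoderStep (F : BinStr →. Option Bool) : DecoderState →. BinStr ⊕ DecoderState :=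
  fun s => (F s.2.2).bind fun o => decoderNext s o

theorem mem_decoderStep {F : BinStr →. Option Bool} {s : DecoderState}
    {r : BinStr ⊕ DecoderState} :
    r ∈ decoderStep F s ↔ ∃ o ∈ F s.2.2, decoderNext s o = some r := by
  simp [decoderStep, Part.mem_bind_iff]

theorem partrec_fix_decoderStep {F : BinStr →. Option Bool} (hF : Partrec F) :
    Partrec (PFun.fix (decoderStep F)) := by
  have h₁ : Partrec fun s : DecoderState => F s.2.2 :=
    hF.comp (Computable.snd.comp Computable.snd)
  have h₂ : Partrec₂ fun (s : DecoderState) (o : Option Bool) =>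
      (decoderNext s o : Part (BinStr ⊕ DecoderState)) :=
    Computable.ofOption primrec_decoderNext.to_comp
  exact Partrec.fix (h₁.bind h₂)

theorem mem_fix_decoderStep {F : BinStr →. Option Bool} {s s' : DecoderState} {o : Option Bool}
    {x : BinStr} (ho : o ∈ F s.2.2) (hs : decoderNext s o = some (Sum.inr s'))
    (hx : x ∈ PFun.fix (decoderStep F) s') : x ∈ PFun.fix (decoderStep F) s :=
  PFun.mem_fix_iff.2 (Or.inr ⟨s', mem_decoderStep.2 ⟨o, ho, hs⟩, hx⟩)

/-- The decoder decides by itself when to stop reading, so that no input on which it succeeds is a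
proper prefix of another one. -/
theorem decoder_prefix_free {F : BinStr →. Option Bool} {s : DecoderState} {x : BinStr}
    (h : x ∈ PFun.fix (decoderStep F) s) :
    ∀ τ y, s.2.1 <+: τ → y ∈ PFun.fix (decoderStep F) (s.1, τ, s.2.2) → s.2.1 = τ := by
  refine PFun.fixInduction' (C := fun s : DecoderState => ∀ τ y, s.2.1 <+: τ →
    y ∈ PFun.fix (decoderStep F) (s.1, τ, s.2.2) → s.2.1 = τ) h ?_ ?_
  · intro s hs
    obtain ⟨o, ho, hn⟩ := mem_decoderStep.1 hs
    intro τ y hτ hy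
    rcases s with ⟨_ | c, _ | ⟨b, τ'⟩, σ⟩ <;> rcases o with _ | b' <;>
      simp only [decoderNext, Option.some.injEq, reduceCtorEq] at hn <;>
      · rcases τ with _ | ⟨b'', τ⟩
        · rfl
        · rcases PFun.mem_fix_iff.1 hy with h | ⟨_, h, _⟩ <;>
            obtain ⟨o, _, h⟩ := mem_decoderStep.1 h <;> simp [decoderNext] at h
  · intro s s' _ hs ih
    obtain ⟨o, ho, hn⟩ := mem_decoderStep.1 hs
    intro τ y hτ hy
    rcases s with ⟨_ | c, τ₀, σ⟩
    · rcases τ₀ with _ | ⟨b, τ₀⟩ <;> simp [decoderNext] at hn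
    -- The longer input is processed with the same value of the predictor.
    have hy' : ∃ r, decoderNext (c + 1, τ, σ) o = some (Sum.inr r) ∧
        y ∈ PFun.fix (decoderStep F) r := by
      rcases PFun.mem_fix_iff.1 hy with h | ⟨r, h, hr⟩ <;>
        obtain ⟨o', ho', h⟩ := mem_decoderStep.1 h <;> cases Part.mem_unique ho' ho
      · rcases o with _ | b <;> rcases τ with _ | ⟨b, τ⟩ <;> simp [decoderNext] at h
      · exact ⟨r, h, hr⟩
    obtain ⟨r, hr, hyr⟩ := hy'
    rcases o with _ | b
    · rcases τ₀ with _ | ⟨b, τ₀⟩ <;> simp only [decoderNext, Option.some.injEq, reduceCtorEq,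
        Sum.inr.injEq] at hn
      rcases τ with _ | ⟨b', τ⟩ <;> simp only [decoderNext, Option.some.injEq, reduceCtorEq,
        Sum.inr.injEq] at hr
      subst hn hr
      obtain ⟨rfl, hτ'⟩ := List.cons_prefix_cons.1 hτ
      exact congrArg _ (ih τ y hτ' hyr)
    · simp only [decoderNext, Option.some.injEq, Sum.inr.injEq] at hn hr
      subst hn hr
      exact ih τ y hτ hyr

theorem BinSeq.pre_succ (X : BinSeq) (n : ℕ) : X.pre (n + 1) = X.pre n ++ [X n] := by
  simp [BinSeq.pre, List.range_succ]

@[simp]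
theorem BinSeq.length_pre (X : BinSeq) (n : ℕ) : (X.pre n).length = n := by
  simp [BinSeq.pre]

/-- If `F` strongly predicts `X`, then for every `c` some longer prefix of `X` is written by the
decoder with `c` predictions, from an input that is `c` bits shorter than the part written. -/
theorem exists_decoder_input {F : BinStr →. Option Bool} {X : BinSeq}
    (hdef : ∀ n, (F (X.pre n)).Dom) (hcorrect : ∀ n b, some b ∈ F (X.pre n) → b = X n)
    (hinf : {n | none ∉ F (X.pre n)}.Infinite) (c m : ℕ) :
    ∃ n τ, τ.length + c + m = n ∧ X.pre n ∈ PFun.fix (decoderStep F) (c, τ, X.pre m) := by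
  induction c generalizing m with
  | zero =>
    refine ⟨m, [], by simp, PFun.fix_stop (mem_decoderStep.2 ?_)⟩
    exact ⟨_, Part.get_mem (hdef m), rfl⟩
  | succ c ih =>
    obtain ⟨N, hN, hmN⟩ := hinf.exists_gt m
    -- Induction on the distance to a place beyond `m` where `F` makes a prediction.
    obtain ⟨e, rfl⟩ := Nat.exists_eq_add_of_le hmN.le
    clear hmN
    induction e generalizing m with
    | zero =>
      obtain ⟨o, ho⟩ := Part.dom_iff_mem.1 (hdef m)
      rcases o with _ | b
      · exact absurd ho hN
      obtain ⟨n, τ, hn, h⟩ := ih (m + 1)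
      refine ⟨n, τ, by omega, ?_⟩
      have hb := hcorrect m b ho
      exact mem_fix_decoderStep ho (by simp [decoderNext, BinSeq.pre_succ, hb]) h
    | succ e ihe =>
      obtain ⟨o, ho⟩ := Part.dom_iff_mem.1 (hdef m)
      rcases o with _ | b
      · obtain ⟨n, τ, hn, h⟩ := ihe (m + 1) (by rwa [show m + 1 + e = m + (e + 1) by omega])
        refine ⟨n, X m :: τ, by simp; omega, ?_⟩
        exact mem_fix_decoderStep ho (by simp [decoderNext, BinSeq.pre_succ]) h
      · obtain ⟨n, τ, hn, h⟩ := ih (m + 1)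
        refine ⟨n, τ, by omega, ?_⟩
        have hb := hcorrect m b ho
        exact mem_fix_decoderStep ho (by simp [decoderNext, BinSeq.pre_succ, hb]) h

/-- The header `0ᵏ1` of a string and what follows it, returned as the initial state of the decoder
that is to use `2k` predictions. -/
def splitHeader : BinStr → Option DecoderState
  | [] => none
  | true :: τ => some (0, τ, [])
  | false :: p => (splitHeader p).map fun s => (s.1 + 2, s.2)

theorem primrec_splitHeader : Primrec splitHeader := by
  refine (Primrec.list_rec (f := fun p : BinStr => p) (g := fun _ => none)
    (h := fun _ x => bif x.1 then some (0, x.2.1, [])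
      else x.2.2.map fun s : DecoderState => (s.1 + 2, s.2)) Primrec.id
    (Primrec.const _) ?_).of_eq ?_
  · refine Primrec.cond (Primrec.fst.comp Primrec.snd) ?_ ?_
    · exact Primrec.option_some.comp ((Primrec.const 0).pair
        ((Primrec.fst.comp (Primrec.snd.comp Primrec.snd)).pair (Primrec.const [])))
    · refine Primrec.option_map (Primrec.snd.comp (Primrec.snd.comp Primrec.snd)) ?_
      exact (Primrec.succ.comp (Primrec.succ.comp (Primrec.fst.comp Primrec.snd))).pair
        (Primrec.snd.comp Primrec.snd)
  · intro p
    induction p with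
    | nil => rfl
    | cons b p ih =>
      cases b
      · simp only [splitHeader, cond_false, ← ih]
      · rfl

theorem splitHeader_eq_some {p : BinStr} {s : DecoderState} (h : splitHeader p = some s) :
    ∃ k, s = (2 * k, s.2.1, []) ∧ p = List.replicate k false ++ true :: s.2.1 := by
  induction p generalizing s with
  | nil => simp [splitHeader] at h
  | cons b p ih =>
    cases b
    · simp only [splitHeader, Option.map_eq_some_iff] at h
      obtain ⟨s', hs', rfl⟩ := h
      obtain ⟨k, h₁, h₂⟩ := ih hs'
      refine ⟨k + 1, ?_, ?_⟩
      · rw [h₁]; rfl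
      · rw [h₂]; simp [List.replicate_succ]
    · simp only [splitHeader, Option.some.injEq] at h
      subst h
      exact ⟨0, rfl, rfl⟩

theorem splitHeader_replicate (k : ℕ) (τ : BinStr) :
    splitHeader (List.replicate k false ++ true :: τ) = some (2 * k, τ, []) := by
  induction k with
  | zero => rfl
  | succ k ih => simp [List.replicate_succ, splitHeader, ih, mul_add]

theorem replicate_append_cons_prefix {k l : ℕ} {τ τ' : BinStr}
    (h : List.replicate k false ++ true :: τ <+: List.replicate l false ++ true :: τ') :
    k = l ∧ τ <+: τ' := by
  induction k generalizing l with
  | zero => cases l <;> simp_all [List.replicate_succ]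
  | succ k ih =>
    cases l with
    | zero => simp [List.replicate_succ] at h
    | succ l =>
      simp only [List.replicate_succ, List.cons_append, List.cons_prefix_cons, true_and] at h
      simpa using ih h

/-- The decompressor of a predictor `F`: on input `0ᵏ1τ` it runs the decoder on `τ` with `2k`
predictions. The predictions save `2k` bits, of which the header takes `k + 1`. -/
def decompress (F : BinStr →. Option Bool) (p : BinStr) : Part BinStr :=
  (splitHeader p : Part DecoderState).bind (PFun.fix (decoderStep F))

theorem partrec_decompress {F : BinStr →. Option Bool} (hF : Partrec F) :
    Partrec (decompress F) :=
  primrec_splitHeader.to_comp.ofOption.bind ((partrec_fix_decoderStep hF).comp Computable.snd)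

theorem decompress_prefix_free {F : BinStr →. Option Bool} {p q : BinStr}
    (hp : (decompress F p).Dom) (hq : (decompress F q).Dom) (hpq : p <+: q) : p = q := by
  obtain ⟨x, hx⟩ := Part.dom_iff_mem.1 hp
  obtain ⟨y, hy⟩ := Part.dom_iff_mem.1 hq
  obtain ⟨s, hs, hx'⟩ := Part.mem_bind_iff.1 hx
  obtain ⟨r, hr, hy'⟩ := Part.mem_bind_iff.1 hy
  obtain ⟨s₁, τ, s₃⟩ := s
  obtain ⟨r₁, τ', r₃⟩ := r
  obtain ⟨k, h₁, rfl⟩ := splitHeader_eq_some (Part.mem_ofOption.1 hs)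
  obtain ⟨l, h₂, rfl⟩ := splitHeader_eq_some (Part.mem_ofOption.1 hr)
  obtain ⟨rfl, h⟩ := replicate_append_cons_prefix hpq
  simp only [Prod.mk.injEq, true_and] at h₁ h₂
  obtain ⟨rfl, rfl⟩ := h₁
  obtain ⟨rfl, rfl⟩ := h₂
  rw [show τ = τ' from decoder_prefix_free hx' _ y h hy']

/-- A strongly predictable sequence has, for every `k`, a prefix that the decompressor obtains from
an input which is `k - 1` bits shorter. -/
theorem exists_decompress_eq_pre {F : BinStr →. Option Bool} {X : BinSeq}
    (hdef : ∀ n, (F (X.pre n)).Dom) (hcorrect : ∀ n b, some b ∈ F (X.pre n) → b = X n)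
    (hinf : {n | none ∉ F (X.pre n)}.Infinite) (k : ℕ) :
    ∃ n p, p.length + k = n + 1 ∧ X.pre n ∈ decompress F p := by
  obtain ⟨n, τ, hn, h⟩ := exists_decoder_input hdef hcorrect hinf (2 * k) 0
  refine ⟨n, List.replicate k false ++ true :: τ, by simp; omega, ?_⟩
  exact Part.mem_bind_iff.2 ⟨_, Part.mem_ofOption.2 (splitHeader_replicate k τ), h⟩

/-! ### Prefixes of the binary expansion -/

/-- The natural number written by a binary string, most significant bit first. -/
def binValue (σ : BinStr) : ℕ :=
  σ.foldl (fun v b => 2 * v + b.toNat) 0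

theorem binValue_pre_binaryExpansion (α : ℝ) (n : ℕ) :
    binValue ((binaryExpansion α).pre n) = ⌊Int.fract α * 2 ^ n⌋₊ := by
  induction n with
  | zero =>
    have : ⌊Int.fract α⌋₊ = 0 := Nat.floor_eq_zero.2 (Int.fract_lt_one α)
    simp [BinSeq.pre, binValue, this]
  | succ n ih =>
    have hhalf : ⌊Int.fract α * 2 ^ (n + 1)⌋₊ / 2 = ⌊Int.fract α * 2 ^ n⌋₊ := by
      rw [← Nat.floor_div_ofNat]
      congr 1
      rw [pow_succ]
      ring
    have hbit : (binaryExpansion α n).toNat = ⌊Int.fract α * 2 ^ (n + 1)⌋₊ % 2 := by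
      have hdigit : Real.digits (Int.fract α) 2 n = 1 ↔
          ⌊Int.fract α * 2 ^ (n + 1)⌋₊ % 2 = 1 := by
        simp [Real.digits, Fin.ext_iff, Fin.ofNat]
      rcases Nat.mod_two_eq_zero_or_one ⌊Int.fract α * 2 ^ (n + 1)⌋₊ with h | h <;>
        simp [binaryExpansion, hdigit, h]
    rw [BinSeq.pre_succ, binValue, List.foldl_concat, ← binValue, ih, hbit]
    omega

theorem primrec_binValue : Primrec binValue := by
  refine Primrec.list_foldl (f := fun σ : BinStr => σ) (g := fun _ => 0)
    (h := fun _ x => 2 * x.1 + x.2.toNat) Primrec.id (Primrec.const 0) ?_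
  exact Primrec.nat_add.comp (Primrec.nat_double.comp (Primrec.fst.comp Primrec.snd))
    ((Primrec.dom_finite Bool.toNat).comp (Primrec.snd.comp Primrec.snd))

/-! ### Strings of high complexity from the bits of the partition function -/

section Escape

variable (u : ℕ → BinStr → Option BinStr) (m : ℕ)

/-- If the weight of stage `t` exceeds `m + 0.σ - 2 ^ (-|σ|)`, a string longer than all outputs
seen by stage `t`. -/
def escapeAt (σ : BinStr) (t : ℕ) : Option BinStr :=
  if 2 ^ t * (m * 2 ^ σ.length + binValue σ) < 2 ^ σ.length * haltedWeight u t + 2 ^ t then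
    some (true :: (outputsBy u t).flatten)
  else none

/-- The value of `escapeAt` at the first stage where it is defined. -/
def escape (σ : BinStr) : Part BinStr :=
  Nat.rfindOpt (escapeAt u m σ)

variable {u}

theorem primrec_escapeAt (hu : Primrec₂ u) : Primrec₂ (escapeAt u m) := by
  have hσ : Primrec fun a : BinStr × ℕ => 2 ^ a.1.length :=
    primrec_two_pow.comp (Primrec.list_length.comp Primrec.fst)
  have ht : Primrec fun a : BinStr × ℕ => 2 ^ a.2 := primrec_two_pow.comp Primrec.snd
  have hl : Primrec fun a : BinStr × ℕ => 2 ^ a.2 * (m * 2 ^ a.1.length + binValue a.1) :=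
    Primrec.nat_mul.comp ht (Primrec.nat_add.comp (Primrec.nat_mul.comp (Primrec.const m) hσ)
      (primrec_binValue.comp Primrec.fst))
  have hr : Primrec fun a : BinStr × ℕ => 2 ^ a.1.length * haltedWeight u a.2 + 2 ^ a.2 :=
    Primrec.nat_add.comp (Primrec.nat_mul.comp hσ ((primrec_haltedWeight hu).comp Primrec.snd)) ht
  have hx : Primrec fun a : BinStr × ℕ => some (true :: (outputsBy u a.2).flatten) :=
    Primrec.option_some.comp (Primrec.list_cons.comp (Primrec.const true)
      (Primrec.list_flatten.comp ((primrec_outputsBy hu).comp Primrec.snd)))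
  exact Primrec.ite (Primrec.nat_lt.comp hl hr) hx (Primrec.const none)

theorem partrec_escape (hu : Primrec₂ u) : Partrec (escape u m) :=
  Partrec.rfindOpt (primrec_escapeAt m hu).to_comp

theorem escapeAt_notMem_outputsBy {σ x : BinStr} {t : ℕ} (hx : escapeAt u m σ t = some x) :
    x ∉ outputsBy u t := by
  intro hmem
  rw [escapeAt] at hx
  split_ifs at hx
  have h := (List.sublist_flatten_of_mem hmem).length_le
  rw [← Option.some.inj hx, List.length_cons] at h
  omega

theorem weight_lt_iff {σ : BinStr} {t : ℕ} :
    2 ^ t * (m * 2 ^ σ.length + binValue σ) < 2 ^ σ.length * haltedWeight u t + 2 ^ t ↔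
      m + binValue σ * (1 / 2 : ℝ) ^ σ.length <
        ∑ p ∈ (haltedBy u t).toFinset, (1 / 2 : ℝ) ^ p.length + (1 / 2) ^ σ.length := by
  rw [← Nat.cast_lt (α := ℝ)]
  push_cast
  rw [cast_haltedWeight]
  generalize ∑ p ∈ (haltedBy u t).toFinset, (1 / 2 : ℝ) ^ p.length = S
  have h₁ : (2 : ℝ) ^ σ.length * (1 / 2) ^ σ.length = 1 := by
    rw [← mul_pow]; norm_num
  have h₂ : (0 : ℝ) < 2 ^ t * 2 ^ σ.length := by positivity
  generalize (2 : ℝ) ^ σ.length = a at *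
  generalize (1 / 2 : ℝ) ^ σ.length = b at *
  have e₁ : (2 : ℝ) ^ t * a * (m + binValue σ * b) = 2 ^ t * (m * a + binValue σ) := by
    linear_combination (2 : ℝ) ^ t * binValue σ * h₁
  have e₂ : (2 : ℝ) ^ t * a * (S + b) = a * (2 ^ t * S) + 2 ^ t := by
    linear_combination (2 : ℝ) ^ t * h₁
  rw [← e₁, ← e₂, mul_lt_mul_iff_right₀ h₂]

end Escape

/-- From the first `n` bits of `Z(1)`, `escape` computes a string that is not an output of any
program shorter than `n`. -/
theorem IsStageApprox.exists_mem_escape {U : BinStr →. BinStr} {u : ℕ → BinStr → Option BinStr}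
    (hu : IsStageApprox U u) (hU : IsPrefixFreeMachine U) (n : ℕ) :
    ∃ x ∈ escape u ⌊partitionFunction U 1⌋₊ ((binaryExpansion (partitionFunction U 1)).pre n),
      ∀ q, x ∈ U q → n ≤ q.length := by
  set α := partitionFunction U 1 with hα
  set σ := (binaryExpansion α).pre n
  have hpos : (0 : ℝ) < (1 / 2) ^ n := by positivity
  have hα₀ : 0 ≤ α := by
    rw [hα, partitionFunction_one]
    exact tsum_nonneg fun _ => by positivity
  have hsplit : (⌊α⌋₊ : ℝ) + Int.fract α = α := by
    rw [natCast_floor_eq_intCast_floor hα₀, Int.floor_add_fract]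
  have hlen : σ.length = n := BinSeq.length_pre _ _
  have hinv : (2 : ℝ) ^ n * (1 / 2) ^ n = 1 := by
    rw [← mul_pow]; norm_num
  -- The bits of `σ` locate `α` in an interval of length `2 ^ (-n)`.
  have hlow : ⌊α⌋₊ + binValue σ * (1 / 2 : ℝ) ^ n ≤ α := by
    have h := Nat.floor_le (a := Int.fract α * 2 ^ n)
      (mul_nonneg (Int.fract_nonneg α) (by positivity))
    rw [← binValue_pre_binaryExpansion] at h
    have := mul_le_mul_of_nonneg_right h hpos.le
    rw [mul_assoc, hinv, mul_one] at this
    linarith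
  have hhigh : α < ⌊α⌋₊ + (binValue σ + 1) * (1 / 2 : ℝ) ^ n := by
    have h := Nat.lt_floor_add_one (Int.fract α * 2 ^ n)
    rw [← binValue_pre_binaryExpansion] at h
    have := mul_lt_mul_of_pos_right h hpos
    rw [mul_assoc, hinv, mul_one] at this
    linarith
  obtain ⟨t, ht⟩ := hu.exists_stage hU hpos
  have hdom : (escape u ⌊α⌋₊ σ).Dom := by
    refine Nat.rfindOpt_dom.2 ⟨t, true :: (outputsBy u t).flatten, if_pos ?_⟩
    rw [weight_lt_iff, hlen]
    linarith
  obtain ⟨x, hx⟩ := Part.dom_iff_mem.1 hdom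
  refine ⟨x, hx, fun q hq => ?_⟩
  obtain ⟨s, hs⟩ := Nat.rfindOpt_spec hx
  have hweight := hs
  rw [Option.mem_def, escapeAt, Option.ite_none_right_eq_some] at hweight
  have hlt := (weight_lt_iff _).1 hweight.1
  rw [hlen] at hlt
  by_contra! hqn
  by_cases hqs : q ∈ haltedBy u s
  · obtain ⟨_, y, hy⟩ := mem_haltedBy.1 hqs
    have hxy := Part.mem_unique hq (hu.mem_iff.2 ⟨s, hy⟩)
    exact escapeAt_notMem_outputsBy _ hs (hxy ▸ mem_outputsBy hqs hy)
  · -- The part of `α` that is missing at stage `s` is below `2 ^ (1 - n)`.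
    have hq' := hu.weight_add_le hU (Part.dom_iff_mem.2 ⟨x, hq⟩) hqs
    have hpow : 2 * (1 / 2 : ℝ) ^ n ≤ (1 / 2) ^ q.length := by
      calc 2 * (1 / 2 : ℝ) ^ n ≤ 2 * (1 / 2) ^ (q.length + 1) := by
            have : (1 / 2 : ℝ) ^ n ≤ (1 / 2) ^ (q.length + 1) :=
              pow_le_pow_of_le_one (by norm_num) (by norm_num) hqn
            linarith
        _ = (1 / 2) ^ q.length := by rw [pow_succ]; ring
    rw [← hα] at hq'
    linarith

/-- For every optimal prefix-free machine, `Z(1)`, that is, Chaitin's `Ω`, is not strongly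
predictable. -/
theorem theorem4 (U : BinStr →. BinStr) (hU : IsOptimalPrefixFreeMachine U) :
    ¬ StronglyPredictable (binaryExpansion (partitionFunction U 1)) := by
  rintro ⟨F, hF, hdef, hcorrect, hinf⟩
  obtain ⟨u, hu⟩ := hU.prefixFreeMachine.partrec.exists_isStageApprox
  let M : BinStr →. BinStr := fun p =>
    (decompress F p).bind (escape u ⌊partitionFunction U 1⌋₊)
  have hM : IsPrefixFreeMachine M :=
    { partrec := (partrec_decompress hF).bind ((partrec_escape _ hu.primrec).comp Computable.snd)
      prefix_free := fun p q hp hq => decompress_prefix_free hp.1 hq.1 }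
  obtain ⟨d, hd⟩ := hU.optimal M hM
  -- The savings of `k - 1 = d + 1` bits outweigh the constant of the simulation of `M` by `U`.
  obtain ⟨n, p, hlen, hp⟩ := exists_decompress_eq_pre hdef hcorrect hinf (d + 2)
  obtain ⟨x, hx, hlong⟩ := hu.exists_mem_escape hU.prefixFreeMachine n
  obtain ⟨q, hq, hqlen⟩ := hd p x (Part.mem_bind_iff.2 ⟨_, hp, hx⟩)
  have := hlong q hq
  omega
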